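/- For $n\ge 0$ let $E_n(x)$ denote the Euler polynomial, defined by $\frac{2e^{xz}}{e^z+1}=\sum_{n\ge 0}E_n(x)\frac{z^n}{n!}$ ($|z|<\pi$). Let $\left(\frac{\cdot}{p}\right)$ be the Legendre symbol and $[a]$ the integral part of $a$. Congruences between rational numbers modulo $p^2$ are congruences in the ring $\mathbb{Z}_p$ of $p$-adic integers (in particular both sides lie in $\mathbb{Z}_p$). Let $p$ be an odd prime. Then $$\sum_{k=0}^{p-1}\frac{\binom{4k}{2k}}{(2k+1)32^k}\equiv \frac{3}{16}p\left(E_{p-2}\left(\tfrac18\right)-E_{p-2}\left(\tfrac38\right)\right)+\begin{cases}\left(\frac{-1}{p}\right)(-1)^{[p/8]}, & \text{if } p\equiv\pm1\pmod 8,\\ 2\left(\frac{-1}{p}\right)(-1)^{[p/8]}, & \text{if } p\equiv\pm3\pmod 8\end{cases}\pmod{p^2}.$$ Moreover, if $p>3$, then $$\sum_{k=0}^{p-1}\frac{\binom{3k}{k}}{2k+1}\left(\frac{2}{27}\right)^k\equiv-1+2\left(\frac{3}{p}\right)+\frac p3\left(E_{p-2}\left(\tfrac16\right)-E_{p-2}\left(\tfrac13\right)\right)\pmod{p^2}$$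 and $$\sum_{k=0}^{p-1}\frac{\binom{6k}{3k}\binom{3k}{k}}{(2k+1)216^k\binom{2k}{k}}\equiv\left(\frac{2}{p}\right)+\frac{5p}{48}\left(E_{p-2}\left(\tfrac1{12}\right)-E_{p-2}\left(\tfrac5{12}\right)\right)\pmod{p^2}.$$ -/

import Mathlib

/-- The Euler polynomial `E_n(x)`, defined by `2 e^{xz} / (e^z + 1) = ∑ E_n(x) z^n / n!`.
The quotient is taken in the ring `ℚ[x]⟦z⟧`; the series `e^z + 1` has rational coefficients and
constant term `2`, so it is already invertible in `ℚ⟦z⟧`. -/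
noncomputable def eulerPolynomial (n : ℕ) : Polynomial ℚ :=
  (n.factorial : ℚ) • PowerSeries.coeff n
    (2 * PowerSeries.rescale (Polynomial.X : Polynomial ℚ) (PowerSeries.exp (Polynomial ℚ)) *
      PowerSeries.map (algebraMap ℚ (Polynomial ℚ)) (PowerSeries.exp ℚ + 1)⁻¹)

/-- The defining generating function, with the denominator cleared. -/
theorem eulerPolynomial_generating :
    PowerSeries.mk (fun n => (1 / (n.factorial : ℚ)) • eulerPolynomial n) *
      (PowerSeries.exp (Polynomial ℚ) + 1) =
    2 * PowerSeries.rescale (Polynomial.X : Polynomial ℚ) (PowerSeries.exp (Polynomial ℚ)) := by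
  have h1 : PowerSeries.mk (fun n => (1 / (n.factorial : ℚ)) • eulerPolynomial n) =
      2 * PowerSeries.rescale (Polynomial.X : Polynomial ℚ) (PowerSeries.exp (Polynomial ℚ)) *
        PowerSeries.map (algebraMap ℚ (Polynomial ℚ)) (PowerSeries.exp ℚ + 1)⁻¹ := by
    ext1 n
    have hn : (n.factorial : ℚ) ≠ 0 := by exact_mod_cast n.factorial_ne_zero
    rw [PowerSeries.coeff_mk, eulerPolynomial, smul_smul, one_div, inv_mul_cancel₀ hn, one_smul]
  have h2 : PowerSeries.exp (Polynomial ℚ) + 1 =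
      PowerSeries.map (algebraMap ℚ (Polynomial ℚ)) (PowerSeries.exp ℚ + 1) := by
    rw [map_add, map_one, PowerSeries.map_exp]
  have h3 : (PowerSeries.exp ℚ + 1)⁻¹ * (PowerSeries.exp ℚ + 1) = 1 := by
    apply PowerSeries.inv_mul_cancel
    rw [map_add, PowerSeries.constantCoeff_exp, map_one]
    norm_num
  rw [h1, h2, mul_assoc, ← map_mul, h3, map_one, mul_one]

/-- `x ≡ y (mod p ^ n)` for rational numbers `x` and `y`, in the ring `ℤ_[p]`: both numbers are
`p`-adic integers, and `p ^ n` divides their difference in `ℤ_[p]`. -/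
def PadicCongr (p : ℕ) [Fact p.Prime] (n : ℕ) (x y : ℚ) : Prop :=
  ∃ a b : ℤ_[p], (a : ℚ_[p]) = (x : ℚ_[p]) ∧ (b : ℚ_[p]) = (y : ℚ_[p]) ∧
    (p : ℤ_[p]) ^ n ∣ a - b

/-! Write S_N for `sineSum N`. At x = -1/4, -1/3, -1/6 the terms of S_p, multiplied by 1/(2x+1) = 2,
3, 3/2, are the summands of the three sums, so the task is to find S_p(-1/m) modulo p² for m = 4, 3,
6.

S_N truncates an expansion of sin((2x+1)π/4)/sin(π/4). Accordingly S_N(x+1) + S_N(x-1) is one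
boundary term (`sineSum_add_one_add_sub_one`), S_N is odd about -1/2, and S_N(n) is a sign for
natural n < N.

Write -1/m = r + pt with 0 ≤ r < p and t p-integral. The denominators (2k+1)!, k < p, contain p at
most once, so p·S_p(r + pt) is quadratic in pt modulo p³. Interpolation at t = -1, 0, 1 therefore
gives S_p(-1/m) modulo p² (`sineSum_add_card_mul_ratCongr`). The nodes 0 and -1 give signs, the
latter by reflection.

The node t = 1 lies beyond the truncation, and the Euler polynomials enter there
(`sineSum_card_add_ratCongr`). The boundary terms are 4p(1/r + 1/(r+1)) modulo p². They are summed
by E(x+1) + E(x) = 2x^(p-2) with j^(p-2) ≡ 1/j, starting from 2^p ≡ 2 - p·E_{p-2}(0). -/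

/-! ### Truncated sine series

`∑_{k<N} (-2)^k (2x+1)/(2k+1) * binom(x+k, 2k)`, a polynomial in `x`. For a natural number
`x = n < N` it is `sin ((2n+1)π/4) / sin (π/4)`. -/

/-- The polynomial `∏_{i<k} (x(x+1) - i(i+1)) = (2k)! * binom(x+k, 2k)`. -/
def sineProd (k : ℕ) (x : ℚ) : ℚ := ∏ i ∈ Finset.range k, (x * (x + 1) - i * (i + 1))

/-- The polynomial `(2x+1)/(2k+1) * binom(x+k, 2k)`. -/
def sineCoeff (k : ℕ) (x : ℚ) : ℚ := (2 * x + 1) * sineProd k x / (2 * k + 1).factorial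

/-- The truncated sum `∑_{k<N} (-2)^k (2x+1)/(2k+1) * binom(x+k, 2k)`. -/
def sineSum (N : ℕ) (x : ℚ) : ℚ := ∑ k ∈ Finset.range N, (-2) ^ k * sineCoeff k x

/-- The sign `sin ((2n+1)π/4) / sin (π/4)`. -/
def sineSign (n : ℕ) : ℚ := (-1) ^ (n / 2)

theorem sineSign_add_two (n : ℕ) : sineSign (n + 2) = -sineSign n := by
  rw [sineSign, sineSign, show (n + 2) / 2 = n / 2 + 1 by omega, pow_succ, mul_neg_one]

theorem sineProd_succ (k : ℕ) (x : ℚ) :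
    sineProd (k + 1) x = sineProd k x * (x * (x + 1) - k * (k + 1)) :=
  Finset.prod_range_succ _ _

theorem sineProd_reflect (k : ℕ) (x : ℚ) : sineProd k (-1 - x) = sineProd k x :=
  Finset.prod_congr rfl fun _ _ => by ring

/-- Since x(x+1) - i(i+1) = (x-i)(x+i+1), `sineProd k x` is the product of the 2k consecutive
factors x-k+1, …, x+k. Shifting x while enlarging k only adds two factors at one end. -/
theorem sineProd_succ_add_one (k : ℕ) (x : ℚ) :
    sineProd (k + 1) (x + 1) = sineProd k x * ((x + k + 1) * (x + k + 2)) := by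
  induction k with
  | zero =>
    simp only [sineProd, Finset.prod_range_zero, Finset.prod_range_one, Nat.cast_zero, zero_add]
    ring
  | succ k ih => rw [sineProd_succ, ih, sineProd_succ]; push_cast; ring

theorem sineProd_succ_sub_one (k : ℕ) (x : ℚ) :
    sineProd (k + 1) (x - 1) = sineProd k x * ((x - k) * (x - k - 1)) := by
  have h := sineProd_succ_add_one k (-1 - x)
  rw [sineProd_reflect, show -1 - x + 1 = -1 - (x - 1) by ring, sineProd_reflect] at h
  rw [h]; ring

theorem sineCoeff_second_difference (k : ℕ) (x : ℚ) :
    sineCoeff (k + 1) (x + 1) + sineCoeff (k + 1) (x - 1) =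
      2 * sineCoeff (k + 1) x + sineCoeff k x := by
  have h : ((2 * k + 1).factorial : ℚ) ≠ 0 := by positivity
  have h2 : ((2 * (k + 1) + 1).factorial : ℚ) =
      (2 * k + 3) * ((2 * k + 2) * (2 * k + 1).factorial) := by
    rw [show 2 * (k + 1) + 1 = (2 * k + 1) + 1 + 1 by ring, Nat.factorial_succ, Nat.factorial_succ]
    push_cast; ring
  have h3 : (2 * (k : ℚ) + 3) ≠ 0 := by positivity
  have h4 : (2 * (k : ℚ) + 2) ≠ 0 := by positivity
  rw [sineCoeff, sineCoeff, sineCoeff, sineCoeff, sineProd_succ_add_one, sineProd_succ_sub_one,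
    sineProd_succ, h2]
  field_simp
  ring

theorem sineSum_succ (N : ℕ) (x : ℚ) :
    sineSum (N + 1) x = sineSum N x + (-2) ^ N * sineCoeff N x :=
  Finset.sum_range_succ _ _

/-- By the second difference, the weights (-2)^k make the sum telescope: (-2)^(k+1)(2c_{k+1} + c_k)
= 2(-2)^(k+1)c_{k+1} - 2(-2)^k c_k. This is the discrete trace of 2cos(π/2) = 0. -/
theorem sineSum_add_one_add_sub_one (N : ℕ) (x : ℚ) :
    sineSum (N + 1) (x + 1) + sineSum (N + 1) (x - 1) = 2 * (-2) ^ N * sineCoeff N x := by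
  induction N with
  | zero => simp [sineSum, sineCoeff, sineProd]; ring
  | succ N ih =>
    rw [sineSum_succ (N + 1), sineSum_succ (N + 1) (x - 1)]
    linear_combination ih + (-2) ^ (N + 1) * sineCoeff_second_difference N x

theorem sineSum_reflect (N : ℕ) (x : ℚ) : sineSum N (-1 - x) = -sineSum N x := by
  rw [sineSum, sineSum, ← Finset.sum_neg_distrib]
  refine Finset.sum_congr rfl fun k _ => ?_
  rw [sineCoeff, sineCoeff, sineProd_reflect]
  ring

theorem sineProd_natCast_eq_zero {n N : ℕ} (h : n < N) : sineProd N n = 0 :=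
  Finset.prod_eq_zero (Finset.mem_range.2 h) (sub_self _)

theorem sineSum_zero_right (N : ℕ) : sineSum (N + 1) 0 = 1 := by
  induction N with
  | zero => simp [sineSum, sineCoeff, sineProd]
  | succ N ih =>
    rw [sineSum_succ, ih, sineCoeff]
    have := sineProd_natCast_eq_zero (Nat.succ_pos N)
    rw [Nat.cast_zero] at this
    simp [this]

theorem sineSum_natCast {n N : ℕ} (h : n ≤ N) : sineSum (N + 1) n = sineSign n := by
  -- The recurrence has step two, so consecutive values are carried together. Its boundary term
  -- vanishes at naturals below N, and reflection supplies the value at -1 needed to start.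
  have key : ∀ n : ℕ, n + 1 ≤ N → sineSum (N + 1) n = sineSign n ∧
      sineSum (N + 1) (n + 1 : ℕ) = sineSign (n + 1) := by
    intro n
    induction n with
    | zero =>
      intro h
      refine ⟨by simpa [sineSign] using sineSum_zero_right N, ?_⟩
      have h1 := sineSum_add_one_add_sub_one N 0
      have h2 := sineProd_natCast_eq_zero (show 0 < N by omega)
      have h3 := sineSum_reflect (N + 1) 0
      rw [Nat.cast_zero] at h2
      rw [sineCoeff, h2, show (0 : ℚ) - 1 = -1 - 0 by ring, h3, sineSum_zero_right] at h1
      have h4 : sineSum (N + 1) (0 + 1) = 1 := by linear_combination h1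
      simpa [sineSign] using h4
    | succ n ih =>
      intro h
      obtain ⟨h1, h2⟩ := ih (by omega)
      refine ⟨h2, ?_⟩
      have h3 := sineSum_add_one_add_sub_one N ((n + 1 : ℕ) : ℚ)
      rw [sineCoeff, sineProd_natCast_eq_zero (show n + 1 < N by omega),
        show (((n + 1 : ℕ) : ℚ) - 1) = n by push_cast; ring, h1] at h3
      rw [sineSign_add_two]
      push_cast at h3 ⊢
      linear_combination h3
  rcases n with _ | n
  · simpa [sineSign] using sineSum_zero_right N
  · exact (key n h).2

theorem sineProd_add_mul_factorial (N s : ℕ) :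
    sineProd N ((N + s : ℕ) : ℚ) * s.factorial = (2 * N + s).factorial := by
  induction N generalizing s with
  | zero => simp [sineProd]
  | succ N ih =>
    have h := ih (s + 1)
    rw [Nat.factorial_succ] at h
    rw [sineProd_succ, show N + 1 + s = N + (s + 1) by ring,
      show 2 * (N + 1) + s = (2 * N + (s + 1)) + 1 by ring, Nat.factorial_succ]
    push_cast at h ⊢
    linear_combination (2 * (N : ℚ) + s + 2) * h

theorem sineCoeff_self (N : ℕ) : sineCoeff N N = 1 := by
  have h := sineProd_add_mul_factorial N 0
  rw [Nat.add_zero, Nat.add_zero, Nat.factorial_zero, Nat.cast_one, mul_one] at h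
  rw [sineCoeff, h, Nat.factorial_succ]
  push_cast
  exact div_self (by positivity)

theorem sineCoeff_self_add_one (N : ℕ) : sineCoeff N ((N + 1 : ℕ) : ℚ) = 2 * N + 3 := by
  have h := sineProd_add_mul_factorial N 1
  rw [Nat.factorial_one, Nat.cast_one, mul_one] at h
  rw [sineCoeff, h, div_eq_iff (by positivity)]
  push_cast
  ring

/-- Shaped for N = p - 1: the factor 2N+2 = 2p exhibits the only p needed, and the remaining
binomial coefficient is 1 modulo p when r ≤ p. -/
theorem sineCoeff_self_add (N r : ℕ) (hr : r ≠ 0) :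
    sineCoeff N ((N + (r + 1) : ℕ) : ℚ) =
      (2 * N + 2 * r + 3) * (2 * N + 2) / (r * (r + 1)) *
        ((2 * N + 2 + (r - 1)).choose (r - 1) : ℕ) := by
  obtain ⟨s, rfl⟩ := Nat.exists_eq_succ_of_ne_zero hr
  have h := sineProd_add_mul_factorial N (s + 1 + 1)
  have h2 : (((2 * N + 2 + s).choose s : ℕ) : ℚ) =
      (2 * N + 2 + s).factorial / (s.factorial * (2 * N + 2).factorial) := by
    rw [Nat.cast_choose ℚ (by omega), Nat.add_sub_cancel]
  have h3 : ((2 * N + 2).factorial : ℚ) = (2 * N + 2) * (2 * N + 1).factorial := by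
    rw [Nat.factorial_succ]; push_cast; ring
  have h4 : ((s + 1 + 1).factorial : ℚ) = (s + 2) * ((s + 1) * s.factorial) := by
    rw [Nat.factorial_succ, Nat.factorial_succ]; push_cast; ring
  have hs : (s.factorial : ℚ) ≠ 0 := by positivity
  have hN : ((2 * N + 1).factorial : ℚ) ≠ 0 := by positivity
  have hN2 : (2 * (N : ℚ) + 2) ≠ 0 := by positivity
  have hs1 : (s : ℚ) + 1 ≠ 0 := by positivity
  have hs2 : (s : ℚ) + 2 ≠ 0 := by positivity
  have hs3 : (s : ℚ) + 1 + 1 ≠ 0 := by positivity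
  have h5 : sineProd N ((N + (s + 1 + 1) : ℕ) : ℚ) =
      (2 * N + 2 + s).factorial / ((s + 2) * ((s + 1) * s.factorial)) := by
    rw [eq_div_iff (by positivity), ← h4, h]
    congr 2; ring
  rw [Nat.succ_eq_add_one, Nat.add_sub_cancel, h2, sineCoeff, h5, h3]
  push_cast
  field_simp
  ring

/-! ### The three hypergeometric summands as sine coefficients -/

theorem choose_four_mul_eq (k : ℕ) :
    ((4 * k).choose (2 * k) : ℚ) / ((2 * (k : ℚ) + 1) * 32 ^ k) =
      2 * ((-2) ^ k * sineCoeff k (-1 / 4)) := by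
  -- At x = -1/m, x(x+1) - i(i+1) = -(mi+1)(mi+m-1)/m². For m = 4 this collects the odd factors of
  -- (4k)!; the even ones give 4^k (2k)!.
  have key : (((4 * k).factorial : ℕ) : ℚ) =
      (-64) ^ k * sineProd k (-1 / 4) * (2 * k).factorial := by
    induction k with
    | zero => simp [sineProd]
    | succ k ih =>
      rw [sineProd_succ, show 4 * (k + 1) = 4 * k + 1 + 1 + 1 + 1 by ring,
        show 2 * (k + 1) = 2 * k + 1 + 1 by ring]
      simp only [Nat.factorial_succ]
      push_cast
      rw [ih]
      ring
  rw [Nat.cast_choose ℚ (by omega), show 4 * k - 2 * k = 2 * k by omega, sineCoeff,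
    Nat.factorial_succ, key, show (-64 : ℚ) = (-2) * 32 by norm_num, mul_pow]
  push_cast
  field_simp
  ring

theorem choose_three_mul_eq (k : ℕ) :
    ((3 * k).choose k : ℚ) / (2 * (k : ℚ) + 1) * (2 / 27) ^ k =
      3 * ((-2) ^ k * sineCoeff k (-1 / 3)) := by
  have key : (((3 * k).factorial : ℕ) : ℚ) = (-27) ^ k * sineProd k (-1 / 3) * k.factorial := by
    induction k with
    | zero => simp [sineProd]
    | succ k ih =>
      rw [sineProd_succ, show 3 * (k + 1) = 3 * k + 1 + 1 + 1 by ring]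
      simp only [Nat.factorial_succ]
      push_cast
      rw [ih]
      ring
  rw [Nat.cast_choose ℚ (by omega), show 3 * k - k = 2 * k by omega, sineCoeff,
    Nat.factorial_succ, key, show (-2 : ℚ) = (-27) * (2 / 27) by norm_num, mul_pow]
  push_cast
  field_simp
  ring

theorem choose_six_mul_eq (k : ℕ) :
    ((6 * k).choose (3 * k) : ℚ) * ((3 * k).choose k : ℚ) /
        ((2 * (k : ℚ) + 1) * 216 ^ k * ((2 * k).choose k : ℚ)) =
      3 / 2 * ((-2) ^ k * sineCoeff k (-1 / 6)) := by
  have key : (((6 * k).factorial : ℕ) : ℚ) * k.factorial =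
      (-432) ^ k * sineProd k (-1 / 6) * (3 * k).factorial * (2 * k).factorial := by
    induction k with
    | zero => simp [sineProd]
    | succ k ih =>
      rw [sineProd_succ, show 6 * (k + 1) = 6 * k + 1 + 1 + 1 + 1 + 1 + 1 by ring,
        show 3 * (k + 1) = 3 * k + 1 + 1 + 1 by ring,
        show 2 * (k + 1) = 2 * k + 1 + 1 by ring]
      simp only [Nat.factorial_succ]
      push_cast
      linear_combination ((6 * (k : ℚ) + 6) * (6 * k + 5) * (6 * k + 4) * (6 * k + 3) *
        (6 * k + 2) * (6 * k + 1) * (k + 1)) * ih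
  rw [Nat.cast_choose ℚ (by omega), Nat.cast_choose ℚ (by omega), Nat.cast_choose ℚ (by omega),
    show 6 * k - 3 * k = 3 * k by omega, show 3 * k - k = 2 * k by omega,
    show 2 * k - k = k by omega, sineCoeff, Nat.factorial_succ]
  have h : (((6 * k).factorial : ℕ) : ℚ) = (-2) ^ k * 216 ^ k * sineProd k (-1 / 6) *
      (3 * k).factorial * (2 * k).factorial / k.factorial := by
    rw [eq_div_iff (by positivity), key, ← mul_pow]; norm_num
  rw [h]
  push_cast
  field_simp
  ring

/-! ### Euler polynomials -/

theorem eulerPolynomial_eval_generating (x : ℚ) :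
    PowerSeries.mk (fun n => (eulerPolynomial n).eval x / n.factorial) *
      (PowerSeries.exp ℚ + 1) = 2 * PowerSeries.rescale x (PowerSeries.exp ℚ) := by
  have h := congrArg (PowerSeries.map (Polynomial.evalRingHom x)) eulerPolynomial_generating
  rw [map_mul, map_mul, map_add, map_one, PowerSeries.map_exp, map_ofNat] at h
  convert h using 2
  · ext n
    simp [div_eq_inv_mul]
  · ext n
    simp [PowerSeries.coeff_rescale, PowerSeries.coeff_exp]
    ring

theorem exp_add_one_ne_zero : PowerSeries.exp ℚ + 1 ≠ 0 := by
  intro h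
  have := congrArg PowerSeries.constantCoeff h
  rw [map_add, PowerSeries.constantCoeff_exp, map_one, map_zero] at this
  norm_num at this

theorem eulerPolynomial_eval_add_one (n : ℕ) (x : ℚ) :
    (eulerPolynomial n).eval (x + 1) = 2 * x ^ n - (eulerPolynomial n).eval x := by
  have h0 := eulerPolynomial_eval_generating x
  have h1 := eulerPolynomial_eval_generating (x + 1)
  have h2 := PowerSeries.exp_mul_exp_eq_exp_add (A := ℚ) x 1
  rw [PowerSeries.rescale_one, RingHom.id_apply] at h2
  rw [← h2, ← mul_assoc, ← h0] at h1
  have h3 : PowerSeries.mk (fun n => (eulerPolynomial n).eval (x + 1) / n.factorial) =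
      PowerSeries.mk (fun n => (eulerPolynomial n).eval x / n.factorial) * PowerSeries.exp ℚ :=
    mul_right_cancel₀ exp_add_one_ne_zero (by rw [h1]; ring)
  have h4 : PowerSeries.mk (fun n => (eulerPolynomial n).eval (x + 1) / n.factorial) +
      PowerSeries.mk (fun n => (eulerPolynomial n).eval x / n.factorial) =
      2 * PowerSeries.rescale x (PowerSeries.exp ℚ) := by
    rw [h3, ← h0]; ring
  have h5 := congrArg (PowerSeries.coeff n) h4
  rw [← map_ofNat (PowerSeries.C (R := ℚ)) 2, PowerSeries.coeff_C_mul, map_add,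
    PowerSeries.coeff_mk, PowerSeries.coeff_mk, PowerSeries.coeff_rescale,
    PowerSeries.coeff_exp] at h5
  have hn : (n.factorial : ℚ) ≠ 0 := by positivity
  simp only [Algebra.algebraMap_self, RingHom.id_apply] at h5
  field_simp at h5
  linear_combination h5

theorem eulerPolynomial_eval_one_sub (n : ℕ) (x : ℚ) :
    (eulerPolynomial n).eval (1 - x) = (-1) ^ n * (eulerPolynomial n).eval x := by
  have h0 := congrArg (PowerSeries.rescale (-1 : ℚ)) (eulerPolynomial_eval_generating x)
  have h1 := eulerPolynomial_eval_generating (1 - x)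
  rw [map_mul, map_mul, map_add, map_one, map_ofNat, PowerSeries.rescale_rescale] at h0
  have h2 := PowerSeries.exp_mul_exp_eq_exp_add (A := ℚ) (-1) 1
  have h3 := PowerSeries.exp_mul_exp_eq_exp_add (A := ℚ) (x * -1) 1
  rw [PowerSeries.rescale_one, RingHom.id_apply] at h2 h3
  rw [show x * -1 + 1 = 1 - x by ring] at h3
  rw [neg_add_cancel, PowerSeries.rescale_zero_apply, PowerSeries.constantCoeff_exp,
    map_one] at h2
  rw [← h3] at h1
  have h4 : PowerSeries.mk (fun n => (eulerPolynomial n).eval (1 - x) / n.factorial) =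
      PowerSeries.rescale (-1 : ℚ)
        (PowerSeries.mk (fun n => (eulerPolynomial n).eval x / n.factorial)) := by
    refine mul_right_cancel₀ exp_add_one_ne_zero ?_
    rw [h1]
    linear_combination (-PowerSeries.exp ℚ) * h0 +
      (PowerSeries.rescale (-1 : ℚ)
        (PowerSeries.mk (fun n => (eulerPolynomial n).eval x / n.factorial))) * h2
  have h5 := congrArg (PowerSeries.coeff n) h4
  rw [PowerSeries.coeff_mk, PowerSeries.coeff_rescale, PowerSeries.coeff_mk, ← mul_div_assoc] at h5
  exact (div_left_inj' (by positivity)).1 h5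

theorem sum_choose_mul_eulerPolynomial_eval (n : ℕ) (x : ℚ) :
    ∑ k ∈ Finset.range (n + 1), (n.choose k : ℚ) * (eulerPolynomial k).eval x +
      (eulerPolynomial n).eval x = 2 * x ^ n := by
  have h := congrArg (PowerSeries.coeff n) (eulerPolynomial_eval_generating x)
  rw [mul_add, mul_one, map_add, PowerSeries.coeff_mul, ← map_ofNat (PowerSeries.C (R := ℚ)) 2,
    PowerSeries.coeff_C_mul, PowerSeries.coeff_rescale, PowerSeries.coeff_exp,
    PowerSeries.coeff_mk, Finset.Nat.sum_antidiagonal_eq_sum_range_succ_mk] at h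
  simp only [PowerSeries.coeff_mk, PowerSeries.coeff_exp, Algebra.algebraMap_self,
    RingHom.id_apply] at h
  have hn : (n.factorial : ℚ) ≠ 0 := by positivity
  have hs : ∑ k ∈ Finset.range (n + 1), (n.choose k : ℚ) * (eulerPolynomial k).eval x =
      n.factorial * ∑ k ∈ Finset.range (n + 1),
        (eulerPolynomial k).eval x / k.factorial * (1 / (n - k).factorial) := by
    rw [Finset.mul_sum]
    refine Finset.sum_congr rfl fun k hk => ?_
    rw [Nat.cast_choose ℚ (Nat.lt_succ_iff.1 (Finset.mem_range.1 hk))]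
    field_simp
  rw [hs]
  simp only [Nat.succ_eq_add_one] at h
  field_simp at h ⊢
  linear_combination h

/-- A recursion whose only denominator is 2, so p-integrality and congruences of arguments pass to
the values for odd p. -/
theorem eulerPolynomial_eval_eq (n : ℕ) (x : ℚ) :
    (eulerPolynomial n).eval x =
      x ^ n - 1 / 2 * ∑ k ∈ Finset.range n, (n.choose k : ℚ) * (eulerPolynomial k).eval x := by
  have h := sum_choose_mul_eulerPolynomial_eval n x
  rw [Finset.sum_range_succ, Nat.choose_self, Nat.cast_one, one_mul] at h
  linear_combination h / 2

/-! ### Congruences between `p`-integral rational numbers -/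

/-- The ring of `p`-integral rational numbers. -/
noncomputable def pIntegral (p : ℕ) [Fact p.Prime] : Subring ℚ :=
  (PadicInt.subring p).comap (Rat.castHom ℚ_[p])

/-- The rational numbers `x` and `y` differ by `p ^ n` times a `p`-integral number. -/
def RatCongr (p : ℕ) [Fact p.Prime] (n : ℕ) (x y : ℚ) : Prop :=
  ∃ z ∈ pIntegral p, x = y + (p : ℚ) ^ n * z

section RatCongr

theorem natCast_ne_zero_of_not_dvd {p m : ℕ} (h : ¬ p ∣ m) : (m : ℚ) ≠ 0 :=
  Nat.cast_ne_zero.2 fun h0 => h (h0 ▸ dvd_zero p)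

variable {p : ℕ} [hp : Fact p.Prime] {n : ℕ} {x y z w : ℚ}

theorem mem_pIntegral : x ∈ pIntegral p ↔ ‖(x : ℚ_[p])‖ ≤ 1 := Iff.rfl

theorem inv_natCast_mem_pIntegral {m : ℕ} (h : ¬ p ∣ m) : (m : ℚ)⁻¹ ∈ pIntegral p := by
  rw [mem_pIntegral, Rat.cast_inv, Rat.cast_natCast, norm_inv,
    Padic.norm_natCast_eq_one_iff.2 ((Nat.Prime.coprime_iff_not_dvd hp.out).2 h), inv_one]

theorem div_natCast_mem_pIntegral {m : ℕ} (h : ¬ p ∣ m) (hx : x ∈ pIntegral p) :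
    x / m ∈ pIntegral p :=
  div_eq_mul_inv x (m : ℚ) ▸ (pIntegral p).mul_mem hx (inv_natCast_mem_pIntegral h)

theorem not_dvd_two (h2 : p ≠ 2) : ¬ p ∣ 2 := fun h =>
  h2 ((Nat.prime_dvd_prime_iff_eq hp.out Nat.prime_two).1 h)

theorem half_mem_pIntegral (h2 : p ≠ 2) : (1 / 2 : ℚ) ∈ pIntegral p := by
  simpa using inv_natCast_mem_pIntegral (not_dvd_two h2)

theorem PadicCongr.of_ratCongr (hy : y ∈ pIntegral p) (h : RatCongr p n x y) :
    PadicCongr p n x y := by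
  have hlift : ∀ q ∈ pIntegral p, ∃ a : ℤ_[p], (a : ℚ_[p]) = (q : ℚ_[p]) := fun q hq =>
    ⟨⟨q, mem_pIntegral.1 hq⟩, rfl⟩
  obtain ⟨z, hz, rfl⟩ := h
  obtain ⟨b, hb⟩ := hlift y hy
  obtain ⟨c, hc⟩ := hlift z hz
  refine ⟨b + p ^ n * c, b, ?_, hb, c, by ring⟩
  push_cast
  rw [hb, hc]

namespace RatCongr

theorem refl (n : ℕ) (x : ℚ) : RatCongr p n x x := ⟨0, zero_mem _, by ring⟩

theorem symm (h : RatCongr p n x y) : RatCongr p n y x := by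
  obtain ⟨a, ha, rfl⟩ := h
  exact ⟨-a, neg_mem ha, by ring⟩

theorem trans (h : RatCongr p n x y) (h' : RatCongr p n y z) : RatCongr p n x z := by
  obtain ⟨a, ha, rfl⟩ := h
  obtain ⟨b, hb, rfl⟩ := h'
  exact ⟨a + b, add_mem ha hb, by ring⟩

theorem add (h : RatCongr p n x y) (h' : RatCongr p n z w) : RatCongr p n (x + z) (y + w) := by
  obtain ⟨a, ha, rfl⟩ := h
  obtain ⟨b, hb, rfl⟩ := h'
  exact ⟨a + b, add_mem ha hb, by ring⟩

theorem neg (h : RatCongr p n x y) : RatCongr p n (-x) (-y) := by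
  obtain ⟨a, ha, rfl⟩ := h
  exact ⟨-a, neg_mem ha, by ring⟩

theorem sub (h : RatCongr p n x y) (h' : RatCongr p n z w) : RatCongr p n (x - z) (y - w) := by
  rw [sub_eq_add_neg, sub_eq_add_neg]
  exact h.add h'.neg

theorem const_mul (hz : z ∈ pIntegral p) (h : RatCongr p n x y) :
    RatCongr p n (z * x) (z * y) := by
  obtain ⟨a, ha, rfl⟩ := h
  exact ⟨z * a, mul_mem hz ha, by ring⟩

theorem mul (hx : x ∈ pIntegral p) (hw : w ∈ pIntegral p) (h : RatCongr p n x y)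
    (h' : RatCongr p n z w) : RatCongr p n (x * z) (y * w) := by
  have h1 := h'.const_mul hx
  have h2 := h.const_mul hw
  rw [mul_comm w, mul_comm w] at h2
  exact h1.trans h2

theorem prime_mul (h : RatCongr p n x y) : RatCongr p (n + 1) (p * x) (p * y) := by
  obtain ⟨a, ha, rfl⟩ := h
  exact ⟨a, ha, by ring⟩

theorem of_prime_mul (h : RatCongr p (n + 1) (p * x) (p * y)) : RatCongr p n x y := by
  obtain ⟨a, ha, h⟩ := h
  refine ⟨a, ha, mul_left_cancel₀ (Nat.cast_ne_zero.2 hp.out.ne_zero) (h.trans ?_)⟩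
  ring

theorem sum {ι : Type*} {s : Finset ι} {f g : ι → ℚ} (h : ∀ i ∈ s, RatCongr p n (f i) (g i)) :
    RatCongr p n (∑ i ∈ s, f i) (∑ i ∈ s, g i) := by
  classical
  induction s using Finset.induction_on with
  | empty => exact refl _ _
  | insert a s ha ih =>
    rw [Finset.sum_insert ha, Finset.sum_insert ha]
    exact (h a (Finset.mem_insert_self a s)).add (ih fun i hi => h i (Finset.mem_insert_of_mem hi))

theorem pow (hx : x ∈ pIntegral p) (hy : y ∈ pIntegral p) (h : RatCongr p n x y) (m : ℕ) :
    RatCongr p n (x ^ m) (y ^ m) := by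
  induction m with
  | zero => simpa using refl n 1
  | succ m ih => rw [pow_succ, pow_succ]; exact mul (pow_mem hx m) hy ih h

theorem of_int {a b : ℤ} (h : (a : ZMod p) = b) : RatCongr p 1 a b := by
  obtain ⟨c, hc⟩ := (ZMod.intCast_eq_intCast_iff_dvd_sub b a p).1 h.symm
  exact ⟨c, intCast_mem _ c, by rw [pow_one]; exact_mod_cast sub_eq_iff_eq_add'.1 hc⟩

end RatCongr

theorem eulerPolynomial_eval_mem_pIntegral (h2 : p ≠ 2) (hx : x ∈ pIntegral p) (n : ℕ) :
    (eulerPolynomial n).eval x ∈ pIntegral p := by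
  induction n using Nat.strong_induction_on with
  | _ n ih =>
    rw [eulerPolynomial_eval_eq]
    exact sub_mem (pow_mem hx n) (mul_mem (half_mem_pIntegral h2) (sum_mem fun k hk =>
      mul_mem (natCast_mem _ _) (ih k (Finset.mem_range.1 hk))))

theorem RatCongr.eulerPolynomial_eval (h2 : p ≠ 2) (hx : x ∈ pIntegral p) (hy : y ∈ pIntegral p)
    (h : RatCongr p n x y) (m : ℕ) :
    RatCongr p n ((eulerPolynomial m).eval x) ((eulerPolynomial m).eval y) := by
  induction m using Nat.strong_induction_on with
  | _ m ih =>
    rw [eulerPolynomial_eval_eq, eulerPolynomial_eval_eq m y]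
    exact (h.pow hx hy m).sub (const_mul (half_mem_pIntegral h2) (sum fun k hk =>
      const_mul (natCast_mem _ _) (ih k (Finset.mem_range.1 hk))))

/-! ### Fermat-type congruences and 2^p modulo p² -/

theorem pow_card_sub_one_ratCongr {m : ℕ} (hm : ¬ p ∣ m) : RatCongr p 1 ((m : ℚ) ^ (p - 1)) 1 := by
  have h : (((m ^ (p - 1) : ℤ)) : ZMod p) = (1 : ℤ) := by
    push_cast
    exact ZMod.pow_card_sub_one_eq_one ((ZMod.natCast_eq_zero_iff m p).not.2 hm)
  simpa using RatCongr.of_int h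

theorem pow_card_sub_two_ratCongr {m : ℕ} (hm : ¬ p ∣ m) :
    RatCongr p 1 ((m : ℚ) ^ (p - 2)) (1 / m) := by
  have h := (pow_card_sub_one_ratCongr hm).const_mul (inv_natCast_mem_pIntegral hm)
  have h0 := natCast_ne_zero_of_not_dvd hm
  rw [show p - 1 = p - 2 + 1 by have := hp.out.two_le; omega, pow_succ', inv_mul_cancel_left₀ h0,
    mul_one, ← one_div] at h
  exact h

theorem half_pow_card_sub_two_ratCongr (h2 : p ≠ 2) {m : ℕ} (hm : ¬ p ∣ m) :
    RatCongr p 1 ((m / 2 : ℚ) ^ (p - 2)) (2 / m) := by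
  have hd : ¬ p ∣ 2 ^ (p - 2) := fun h => not_dvd_two h2 (hp.out.dvd_of_dvd_pow h)
  have h := (pow_card_sub_two_ratCongr hm).const_mul (inv_natCast_mem_pIntegral hd)
  have h' := ((pow_card_sub_two_ratCongr (not_dvd_two h2)).const_mul
    (mul_mem (inv_natCast_mem_pIntegral hd) (inv_natCast_mem_pIntegral hm))).const_mul
    (natCast_mem (pIntegral p) 2)
  have h0 := natCast_ne_zero_of_not_dvd hm
  have e1 : ((2 ^ (p - 2) : ℕ) : ℚ)⁻¹ * (m : ℚ) ^ (p - 2) = (m / 2 : ℚ) ^ (p - 2) := by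
    rw [div_pow]; push_cast; field_simp
  have e2 : ((2 : ℕ) : ℚ) * (((2 ^ (p - 2) : ℕ) : ℚ)⁻¹ * (m : ℚ)⁻¹ * ((2 : ℕ) : ℚ) ^ (p - 2)) =
      2 / m := by push_cast; field_simp
  have e3 : ((2 : ℕ) : ℚ) * (((2 ^ (p - 2) : ℕ) : ℚ)⁻¹ * (m : ℚ)⁻¹ * (1 / ((2 : ℕ) : ℚ))) =
      ((2 ^ (p - 2) : ℕ) : ℚ)⁻¹ * (1 / m) := by push_cast; field_simp
  rw [e1] at h
  rw [e2, e3] at h'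
  exact h.trans h'.symm

theorem choose_card_sub_one_ratCongr {j : ℕ} (hj : j < p) :
    RatCongr p 1 ((p - 1).choose j : ℕ) ((-1) ^ j) := by
  have h : ((((p - 1).choose j : ℕ) : ℤ) : ZMod p) = (((-1) ^ j : ℤ) : ZMod p) := by
    push_cast
    induction j with
    | zero => simp
    | succ j ih =>
      have h1 : p.choose (j + 1) = (p - 1).choose j + (p - 1).choose (j + 1) := by
        conv_lhs => rw [show p = p - 1 + 1 by have := hp.out.pos; omega]
        exact Nat.choose_succ_succ _ _
      have h2 : ((p.choose (j + 1) : ℕ) : ZMod p) = 0 :=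
        (ZMod.natCast_eq_zero_iff _ _).2 (hp.out.dvd_choose_self (by omega) hj)
      rw [h1, Nat.cast_add, ih (by omega)] at h2
      rw [pow_succ]
      linear_combination h2
  simpa using RatCongr.of_int h

theorem sum_alternating_pow (n m : ℕ) :
    ∑ j ∈ Finset.range m, (-1 : ℚ) ^ j * (2 * (j : ℚ) ^ n) =
      (eulerPolynomial n).eval 0 - (-1) ^ m * (eulerPolynomial n).eval (m : ℚ) := by
  induction m with
  | zero => simp
  | succ m ih =>
    rw [Finset.sum_range_succ, ih, Nat.cast_succ, eulerPolynomial_eval_add_one]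
    ring

/-- Expand 2^p binomially: binom(p, j+1) = p/(j+1)·binom(p-1, j) ≡ p(-1)^j (j+1)^(p-2). The
alternating power sum equals (E(0) + E(p))/2, which is E(0) modulo p. -/
theorem two_pow_card_ratCongr (h2 : p ≠ 2) :
    RatCongr p 2 (2 ^ p) (2 - p * (eulerPolynomial (p - 2)).eval 0) := by
  have hp2 := hp.out.two_le
  have hodd : Odd p := hp.out.odd_of_ne_two h2
  have hsum : (2 : ℚ) ^ p = 2 + ∑ j ∈ Finset.range (p - 1), ((p.choose (j + 1) : ℕ) : ℚ) := by
    have h := Nat.sum_range_choose p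
    obtain ⟨q, rfl⟩ : ∃ q, p = q + 1 := ⟨p - 1, by omega⟩
    rw [Finset.sum_range_succ, Finset.sum_range_succ', Nat.choose_self, Nat.choose_zero_right] at h
    rw [Nat.add_sub_cancel]
    have h' : (((∑ k ∈ Finset.range q, (q + 1).choose (k + 1)) + 1 + 1 : ℕ) : ℚ) =
      ((2 ^ (q + 1) : ℕ) : ℚ) := by rw [h]
    push_cast at h' ⊢
    linear_combination -h'
  have hterm : ∀ j ∈ Finset.range (p - 1), RatCongr p 2 ((p.choose (j + 1) : ℕ) : ℚ)
      (p * -((-1) ^ (j + 1) * ((j + 1 : ℕ) : ℚ) ^ (p - 2))) := by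
    intro j hj
    rw [Finset.mem_range] at hj
    have hd : ¬ p ∣ j + 1 := Nat.not_dvd_of_pos_of_lt (by omega) (by omega)
    have h0 := natCast_ne_zero_of_not_dvd hd
    have h1 : ((p.choose (j + 1) : ℕ) : ℚ) = p * ((((j + 1 : ℕ) : ℚ))⁻¹ * ((p - 1).choose j : ℕ)) := by
      have h := Nat.add_one_mul_choose_eq (p - 1) j
      rw [show p - 1 + 1 = p by omega] at h
      have h' : (p : ℚ) * ((p - 1).choose j : ℕ) = (p.choose (j + 1) : ℕ) * (j + 1 : ℕ) := by
        exact_mod_cast h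
      rw [mul_left_comm, h']
      field_simp
    have h3 := (choose_card_sub_one_ratCongr (p := p) (show j < p by omega)).const_mul
      (inv_natCast_mem_pIntegral hd)
    have h4 := (pow_card_sub_two_ratCongr hd).const_mul (pow_mem (neg_mem (one_mem _)) j)
    rw [h1]
    refine RatCongr.prime_mul (h3.trans ?_)
    convert h4.symm using 1
    · ring
    · ring
  have h := (RatCongr.refl (p := p) 2 2).add (RatCongr.sum hterm)
  rw [← hsum, ← Finset.mul_sum, Finset.sum_neg_distrib] at h
  refine h.trans ?_
  have hs := sum_alternating_pow (p - 2) p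
  have hs2 : ∑ j ∈ Finset.range p, (-1 : ℚ) ^ j * (2 * (j : ℚ) ^ (p - 2)) =
      2 * ∑ j ∈ Finset.range (p - 1), (-1 : ℚ) ^ (j + 1) * ((j + 1 : ℕ) : ℚ) ^ (p - 2) := by
    obtain ⟨q, hq⟩ : ∃ q, p = q + 1 := ⟨p - 1, by omega⟩
    have h3 : p - 2 ≠ 0 := by omega
    rw [show p - 1 = q by omega]
    conv_lhs => rw [hq, ← hq]
    rw [show Finset.range p = Finset.range (q + 1) by rw [hq], Finset.sum_range_succ', Nat.cast_zero,
      zero_pow h3, mul_zero, mul_zero, add_zero, Finset.mul_sum]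
    exact Finset.sum_congr rfl fun _ _ => by ring
  rw [hs2, hodd.neg_one_pow] at hs
  have he := RatCongr.eulerPolynomial_eval h2 (natCast_mem _ p) (zero_mem _)
    (⟨1, one_mem _, by ring⟩ : RatCongr p 1 (p : ℚ) 0) (p - 2)
  have h5 := (((RatCongr.refl (p := p) 1 ((eulerPolynomial (p - 2)).eval 0)).add he).const_mul
    (neg_mem (half_mem_pIntegral h2))).prime_mul
  convert (RatCongr.refl (p := p) 2 2).add h5 using 1
  · linear_combination (-(p : ℚ) / 2) * hs
  · ring

theorem choose_two_mul_card_add_ratCongr {s : ℕ} (hs : s < p) :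
    RatCongr p 1 ((2 * p + s).choose s : ℕ) 1 := by
  have h := Choose.choose_modEq_choose_mod_mul_choose_div_nat (p := p) (n := 2 * p + s) (k := s)
  rw [Nat.div_eq_of_lt hs, Nat.choose_zero_right, mul_one, Nat.mod_eq_of_lt hs,
    show 2 * p + s = s + p * 2 by ring, Nat.add_mul_mod_self_left, Nat.mod_eq_of_lt hs,
    Nat.choose_self] at h
  have h' : ((((2 * p + s).choose s : ℕ) : ℤ) : ZMod p) = ((1 : ℤ) : ZMod p) := by
    push_cast
    rw [show 2 * p + s = s + p * 2 by ring]
    have h1 := (ZMod.natCast_eq_natCast_iff _ _ _).2 h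
    simpa using h1
  simpa using RatCongr.of_int h'

/-- Among 1, …, m only p itself can be a multiple of p. -/
theorem card_div_factorial_mem_pIntegral {m : ℕ} (hm : m < 2 * p) :
    (p : ℚ) / m.factorial ∈ pIntegral p := by
  induction m with
  | zero => simp
  | succ m ih =>
    by_cases h : m + 1 = p
    · rw [Nat.factorial_succ, h, Nat.cast_mul, ← div_div,
        div_self (Nat.cast_ne_zero.2 hp.out.ne_zero)]
      exact div_natCast_mem_pIntegral ((hp.out.dvd_factorial).not.2 (by omega)) (one_mem _)
    · rw [Nat.factorial_succ, mul_comm, Nat.cast_mul, ← div_div]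
      refine div_natCast_mem_pIntegral ?_ (ih (by omega))
      rintro ⟨c, hc⟩
      have hp0 := hp.out.pos
      have : c < 2 := by
        by_contra hc2
        have := Nat.mul_le_mul_left p (not_lt.1 hc2)
        omega
      interval_cases c <;> omega

end RatCongr

/-! ### Values of the truncated sine series modulo `p ^ 2` -/

/-- The difference `E_{p-2}(-x/2) - E_{p-2}((1+x)/2)` of values of an Euler polynomial. -/
noncomputable def eulerDiff (p : ℕ) (x : ℚ) : ℚ :=
  (eulerPolynomial (p - 2)).eval (-x / 2) - (eulerPolynomial (p - 2)).eval ((1 + x) / 2)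

section SineSum

variable {p : ℕ} [hp : Fact p.Prime]

theorem two_add_one_le (h2 : p ≠ 2) : 3 ≤ p := by
  have := hp.out.two_le
  omega

theorem odd_card_sub_two (h2 : p ≠ 2) : Odd (p - 2) := by
  obtain ⟨q, hq⟩ := hp.out.odd_of_ne_two h2
  have := two_add_one_le h2
  exact ⟨q - 1, by omega⟩

theorem eulerPolynomial_eval_half (h2 : p ≠ 2) : (eulerPolynomial (p - 2)).eval (1 / 2) = 0 := by
  have h := eulerPolynomial_eval_one_sub (p - 2) (1 / 2)
  rw [(odd_card_sub_two h2).neg_one_pow, show (1 : ℚ) - 1 / 2 = 1 / 2 by norm_num] at h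
  linarith

theorem eulerDiff_zero (h2 : p ≠ 2) : eulerDiff p 0 = (eulerPolynomial (p - 2)).eval 0 := by
  rw [eulerDiff, add_zero, eulerPolynomial_eval_half h2, sub_zero, neg_zero, zero_div]

theorem eulerDiff_one_ratCongr (h2 : p ≠ 2) :
    RatCongr p 1 (eulerDiff p 1) ((eulerPolynomial (p - 2)).eval 0 - 4) := by
  have h3 := two_add_one_le h2
  have h := eulerPolynomial_eval_add_one (p - 2) (-1 / 2)
  have h' := eulerPolynomial_eval_add_one (p - 2) 0
  rw [show (-1 / 2 : ℚ) + 1 = 1 / 2 by norm_num, eulerPolynomial_eval_half h2] at h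
  rw [zero_pow (by omega), zero_add] at h'
  have h4 := (half_pow_card_sub_two_ratCongr h2 (m := 1) hp.out.not_dvd_one)
  have h5 := (RatCongr.refl (p := p) 1 ((eulerPolynomial (p - 2)).eval 0)).sub
    (h4.const_mul (natCast_mem _ 2))
  have h6 : (-1 / 2 : ℚ) ^ (p - 2) = -(((1 : ℕ) : ℚ) / 2) ^ (p - 2) := by
    rw [← (odd_card_sub_two h2).neg_pow]; norm_num
  convert h5 using 1
  · rw [eulerDiff, show (1 + 1 : ℚ) / 2 = 1 by norm_num]
    push_cast at h6 ⊢
    linear_combination h - h' + 2 * h6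
  · norm_num

/-- The functional equation at -(r+1)/2 and at r/2 pairs the four Euler values; Fermat turns the
powers into reciprocals. The right side matches, up to sign, the boundary term of the sine
recurrence divided by p. -/
theorem eulerDiff_add_eulerDiff_ratCongr (h2 : p ≠ 2) {r : ℕ} (hr : 0 < r) (hrp : r + 1 < p) :
    RatCongr p 1 (eulerDiff p (r + 1) + eulerDiff p (r - 1)) (-4 * (1 / r + 1 / (r + 1))) := by
  have ha := half_pow_card_sub_two_ratCongr h2
    (Nat.not_dvd_of_pos_of_lt hr (show r < p by omega))
  have hb := half_pow_card_sub_two_ratCongr h2 (Nat.not_dvd_of_pos_of_lt (Nat.add_one_pos r) hrp)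
  have h := (ha.add hb).const_mul (neg_mem (natCast_mem (pIntegral p) 2))
  have h3 := eulerPolynomial_eval_add_one (p - 2) (-((r : ℚ) + 1) / 2)
  have h4 := eulerPolynomial_eval_add_one (p - 2) ((r : ℚ) / 2)
  have h5 : (-((r : ℚ) + 1) / 2) ^ (p - 2) = -(((r + 1 : ℕ) : ℚ) / 2) ^ (p - 2) := by
    rw [← (odd_card_sub_two h2).neg_pow]; push_cast; ring_nf
  rw [show -((r : ℚ) + 1) / 2 + 1 = -((r : ℚ) - 1) / 2 by ring] at h3
  rw [show (r : ℚ) / 2 + 1 = (1 + ((r : ℚ) + 1)) / 2 by ring] at h4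
  convert h using 1
  · rw [eulerDiff, eulerDiff, show (1 + ((r : ℚ) - 1)) / 2 = (r : ℚ) / 2 by ring]
    push_cast at h5 ⊢
    linear_combination h3 - h4 + 2 * h5
  · push_cast; ring

theorem even_card_sub_one (h2 : p ≠ 2) : Even (p - 1) := hp.out.even_sub_one h2

theorem two_mul_neg_two_pow (h2 : p ≠ 2) : 2 * (-2 : ℚ) ^ (p - 1) = 2 ^ p := by
  rw [(even_card_sub_one h2).neg_pow, ← pow_succ', Nat.sub_add_cancel hp.out.one_le]

theorem two_pow_mul_sineCoeff_ratCongr (h2 : p ≠ 2) {r : ℕ} (hr : 0 < r) (hrp : r + 1 < p) :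
    RatCongr p 2 (2 ^ p * sineCoeff (p - 1) ((p + r : ℕ) : ℚ))
      (p * (4 * (1 / r + 1 / (r + 1)))) := by
  have hd : ¬ p ∣ r * (r + 1) := fun h => by
    rcases hp.out.dvd_mul.1 h with h | h
    · exact Nat.not_dvd_of_pos_of_lt hr (by omega) h
    · exact Nat.not_dvd_of_pos_of_lt (Nat.add_one_pos r) hrp h
  have hc := choose_two_mul_card_add_ratCongr (p := p) (s := r - 1) (by omega)
  have h1 := pow_card_sub_one_ratCongr (not_dvd_two h2)
  have h3 : RatCongr p 1 (2 * p + 2 * r + 1 : ℚ) (2 * r + 1) := ⟨2, natCast_mem _ 2, by ring⟩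
  have hm : ∀ n : ℕ, (n : ℚ) ∈ pIntegral p := natCast_mem _
  have h4 := RatCongr.mul (p := p) (hm _) (w := (2 * r + 1) * 1)
    (by simpa using hm (2 * r + 1)) hc
    (RatCongr.mul (by simpa using hm (2 * p + 2 * r + 1)) (by simp) h3 h1)
  have h5 := (h4.const_mul (mul_mem (hm 4) (inv_natCast_mem_pIntegral hd))).prime_mul
  have hr0 : (r : ℚ) ≠ 0 := by positivity
  have hr1 : (r : ℚ) + 1 ≠ 0 := by positivity
  have h6 := sineCoeff_self_add (p - 1) r hr.ne'
  have hp1 := hp.out.one_le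
  rw [show p - 1 + (r + 1) = p + r by omega, show 2 * (p - 1) + 2 + (r - 1) = 2 * p + (r - 1) by omega,
    Nat.cast_sub hp1] at h6
  have h7 : (2 : ℚ) ^ p = 2 * 2 ^ (p - 1) := by
    rw [← pow_succ', Nat.sub_add_cancel hp1]
  convert h5 using 1
  · rw [h6, h7]; push_cast; field_simp; ring
  · push_cast; field_simp; ring

/-- Both sides obey the same two-step recursion in r modulo p², so agreement at r = 0 and r = 1
suffices. -/
theorem sineSum_card_add_ratCongr (h2 : p ≠ 2) {r : ℕ} (hr : r < p) :
    RatCongr p 2 (sineSum p ((p + r : ℕ) : ℚ))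
      (sineSign (p + r) + 2 * sineSign r - p * eulerDiff p r) := by
  have h3 := two_add_one_le h2
  have hN : p - 1 + 1 = p := by omega
  have hrec : ∀ s : ℕ, sineSum p (s + 1) = -sineSum p (s - 1) + 2 ^ p * sineCoeff (p - 1) s := by
    intro s
    have h := sineSum_add_one_add_sub_one (p - 1) s
    rw [hN, two_mul_neg_two_pow h2] at h
    linear_combination h
  have hsmall : ∀ s < p, sineSum p s = sineSign s := by
    intro s hs
    have h := sineSum_natCast (n := s) (N := p - 1) (by omega)
    rwa [hN] at h
  have hsgn0 : sineSign p = -sineSign (p - 2) := by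
    rw [← sineSign_add_two, Nat.sub_add_cancel (by omega)]
  have hsgn1 : sineSign (p + 1) = -sineSign (p - 1) := by
    rw [← sineSign_add_two]; congr 1; omega
  have h2p := two_pow_card_ratCongr h2
  have hpc : ((p - 1 : ℕ) : ℚ) = (p : ℚ) - 1 := by rw [Nat.cast_sub (by omega), Nat.cast_one]
  induction r using Nat.twoStepInduction with
  | zero =>
    have h := hrec (p - 1)
    rw [sineCoeff_self, hpc, show (p : ℚ) - 1 - 1 = ((p - 2 : ℕ) : ℚ) by
      rw [Nat.cast_sub (by omega)]; push_cast; ring, hsmall _ (by omega), sub_add_cancel] at h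
    rw [Nat.add_zero, h, hsgn0, Nat.cast_zero, eulerDiff_zero h2]
    convert (RatCongr.refl (p := p) 2 (-sineSign (p - 2))).add h2p using 1
    · ring
    · simp [sineSign]; ring
  | one =>
    have h := hrec p
    have hc := sineCoeff_self_add_one (p - 1)
    rw [hN] at hc
    rw [hc, ← Nat.cast_one, ← Nat.cast_sub (by omega), hsmall _ (by omega), ← Nat.cast_add, hpc] at h
    have h4 := h2p.const_mul (natCast_mem (pIntegral p) (1 + 2 * p))
    have h5 := (eulerDiff_one_ratCongr h2).prime_mul
    -- (1+2p)(2 - pE(0)) = 2 - p(E(0) - 4) - 2p²E(0), and E(0) - 4 is `eulerDiff p 1` modulo p.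
    have h6 := (h4.trans ⟨-2 * (eulerPolynomial (p - 2)).eval 0,
      mul_mem (neg_mem (natCast_mem _ 2)) (eulerPolynomial_eval_mem_pIntegral h2 (zero_mem _) _),
      by push_cast; ring⟩).trans ((RatCongr.refl (p := p) 2 2).sub h5.symm)
    rw [h, hsgn1]
    convert (RatCongr.refl (p := p) 2 (-sineSign (p - 1))).add h6 using 1
    · push_cast; ring
    · simp [sineSign]; ring
  | more r ih _ =>
    have ih := ih (by omega)
    have h := hrec (p + (r + 1))
    have hc := two_pow_mul_sineCoeff_ratCongr h2 (Nat.add_one_pos r) hr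
    have he := (eulerDiff_add_eulerDiff_ratCongr h2 (Nat.add_one_pos r) hr).prime_mul
    have e1 : (((p + (r + 1) : ℕ) : ℚ)) + 1 = ((p + (r + 2) : ℕ) : ℚ) := by push_cast; ring
    have e2 : (((p + (r + 1) : ℕ) : ℚ)) - 1 = ((p + r : ℕ) : ℚ) := by push_cast; ring
    have e3 : (((r + 1 : ℕ) : ℚ)) + 1 = ((r + 2 : ℕ) : ℚ) := by push_cast; ring
    have e4 : (((r + 1 : ℕ) : ℚ)) - 1 = (r : ℚ) := by push_cast; ring
    rw [e1, e2] at h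
    rw [e3, e4] at he
    rw [h, show p + (r + 2) = p + r + 2 from rfl, sineSign_add_two, sineSign_add_two]
    convert ((ih.neg.add hc).add he).sub (RatCongr.refl (p := p) 2
      (p * (eulerDiff p (r + 2 : ℕ) + eulerDiff p r))) using 1
    · ring
    · push_cast; ring

end SineSum

/-! ### Interpolation along r + pt -/

section SineSum

variable {p : ℕ} [hp : Fact p.Prime]

/-- The function `f` is, modulo `p ^ 3` and on `p`-integral arguments, a quadratic polynomial in
`p * t` with `p`-integral coefficients. -/
def IsQuadraticModCube (p : ℕ) [Fact p.Prime] (f : ℚ → ℚ) : Prop :=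
  ∃ a ∈ pIntegral p, ∃ b ∈ pIntegral p, ∃ c ∈ pIntegral p, ∀ t ∈ pIntegral p,
    RatCongr p 3 (f t) (a + b * (p * t) + c * (p * t) ^ 2)

namespace IsQuadraticModCube

variable {f g : ℚ → ℚ}

theorem const {a : ℚ} (ha : a ∈ pIntegral p) : IsQuadraticModCube p fun _ => a :=
  ⟨a, ha, 0, zero_mem _, 0, zero_mem _, fun t _ => by simpa using RatCongr.refl 3 a⟩

theorem prime_mul_self : IsQuadraticModCube p fun t => p * t :=
  ⟨0, zero_mem _, 1, one_mem _, 0, zero_mem _, fun t _ => by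
    simpa using RatCongr.refl (p := p) 3 (p * t)⟩

theorem add (hf : IsQuadraticModCube p f) (hg : IsQuadraticModCube p g) :
    IsQuadraticModCube p fun t => f t + g t := by
  obtain ⟨a, ha, b, hb, c, hc, hf⟩ := hf
  obtain ⟨a', ha', b', hb', c', hc', hg⟩ := hg
  refine ⟨_, add_mem ha ha', _, add_mem hb hb', _, add_mem hc hc', fun t ht => ?_⟩
  convert (hf t ht).add (hg t ht) using 1
  ring

theorem mul (hf : IsQuadraticModCube p f) (hg : IsQuadraticModCube p g) :
    IsQuadraticModCube p fun t => f t * g t := by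
  obtain ⟨a, ha, b, hb, c, hc, hf⟩ := hf
  obtain ⟨a', ha', b', hb', c', hc', hg⟩ := hg
  refine ⟨_, mul_mem ha ha', _, add_mem (mul_mem ha hb') (mul_mem hb ha'), _,
    add_mem (add_mem (mul_mem ha hc') (mul_mem hb hb')) (mul_mem hc ha'), fun t ht => ?_⟩
  obtain ⟨z, hz, h⟩ := hf t ht
  obtain ⟨z', hz', h'⟩ := hg t ht
  have hp := natCast_mem (pIntegral p) p
  -- The cubic and quartic terms in pt are divisible by p³ and join the error.
  refine ⟨t ^ 3 * (b * c' + c * b') + p * t ^ 4 * (c * c') +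
    (a + b * (p * t) + c * (p * t) ^ 2) * z' + z * (a' + b' * (p * t) + c' * (p * t) ^ 2) +
    p ^ 3 * (z * z'), ?_, by
      change f t * g t = _
      rw [h, h']; ring⟩
  repeat' first | assumption | apply add_mem | apply mul_mem | apply pow_mem

theorem sum {f : ℕ → ℚ → ℚ} {n : ℕ} (h : ∀ k < n, IsQuadraticModCube p (f k)) :
    IsQuadraticModCube p fun t => ∑ k ∈ Finset.range n, f k t := by
  induction n with
  | zero => simpa using const (zero_mem (pIntegral p))
  | succ n ih =>
    simp only [Finset.sum_range_succ]
    exact (ih fun k hk => h k (by omega)).add (h n (by omega))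

theorem prod {f : ℕ → ℚ → ℚ} {n : ℕ} (h : ∀ k < n, IsQuadraticModCube p (f k)) :
    IsQuadraticModCube p fun t => ∏ k ∈ Finset.range n, f k t := by
  induction n with
  | zero => simpa using const (one_mem (pIntegral p))
  | succ n ih =>
    simp only [Finset.prod_range_succ]
    exact (ih fun k hk => h k (by omega)).mul (h n (by omega))

/-- Lagrange interpolation at `-1`, `0` and `1`. -/
theorem ratCongr (h2 : p ≠ 2) (hf : IsQuadraticModCube p f) {t : ℚ} (ht : t ∈ pIntegral p) :
    RatCongr p 3 (f t)
      ((1 - t ^ 2) * f 0 + 1 / 2 * (t ^ 2 + t) * f 1 + 1 / 2 * (t ^ 2 - t) * f (-1)) := by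
  obtain ⟨a, -, b, -, c, -, hf⟩ := hf
  have h1 := one_mem (pIntegral p)
  have hh := half_mem_pIntegral h2
  have ht2 := pow_mem ht 2
  refine (hf t ht).trans ?_
  convert (((hf 0 (zero_mem _)).const_mul (sub_mem h1 ht2)).add
    ((hf 1 h1).const_mul (mul_mem hh (add_mem ht2 ht)))).add
    ((hf (-1) (neg_mem h1)).const_mul (mul_mem hh (sub_mem ht2 ht))) |>.symm using 1
  ring

/-- The factor p clears the possible single p in (2k+1)!; working modulo p³ leaves p² once it is
cancelled. -/
theorem card_mul_sineSum {r : ℚ} (hr : r ∈ pIntegral p) :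
    IsQuadraticModCube p fun t => p * sineSum p (r + p * t) := by
  have hx : IsQuadraticModCube p fun t => r + p * t := (const hr).add prime_mul_self
  have hm : ∀ n : ℤ, (n : ℚ) ∈ pIntegral p := intCast_mem _
  simp only [sineSum, Finset.mul_sum]
  refine sum fun k hk => ?_
  have hprod : IsQuadraticModCube p fun t => sineProd k (r + p * t) := by
    refine prod fun i _ => ?_
    convert (hx.mul (hx.add (const (one_mem _)))).add (const (hm (-(i * (i + 1))))) using 2
    push_cast
    ring
  convert (const (mul_mem (pow_mem (hm (-2)) k)
    (card_div_factorial_mem_pIntegral (p := p) (m := 2 * k + 1) (by omega)))).mul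
    ((((const (hm 2)).mul hx).add (const (one_mem _))).mul hprod) using 2
  rw [sineCoeff]
  push_cast
  ring

end IsQuadraticModCube

/-- The two angles add up to pπ with p odd, so their sines agree. -/
theorem sineSign_card_add (h2 : p ≠ 2) {r : ℕ} (hr : r < p) :
    sineSign (p + r) = sineSign (p - 1 - r) := by
  obtain ⟨q, hq⟩ := hp.out.odd_of_ne_two h2
  refine neg_one_pow_congr ?_
  rw [Nat.even_iff, Nat.even_iff]
  omega

theorem sineSum_add_card_mul_ratCongr (h2 : p ≠ 2) {r : ℕ} (hr : r < p) {t : ℚ}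
    (ht : t ∈ pIntegral p) :
    RatCongr p 2 (sineSum p (r + p * t))
      (sineSign r + t * (sineSign r + sineSign (p - 1 - r)) -
        1 / 2 * (t * (t + 1)) * (p * eulerDiff p r)) := by
  have hp1 := hp.out.one_le
  have hsmall : ∀ s < p, sineSum p s = sineSign s := by
    intro s hs
    have h := sineSum_natCast (n := s) (N := p - 1) (by omega)
    rwa [Nat.sub_add_cancel hp1] at h
  -- The node r - p is the reflection -1 - (p-1-r) of a natural number below p.
  have hneg : sineSum p (r + p * (-1)) = -sineSign (p - 1 - r) := by
    rw [← hsmall _ (by omega), ← sineSum_reflect]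
    congr 1
    rw [Nat.cast_sub (by omega), Nat.cast_sub hp1]
    push_cast
    ring
  have h := (IsQuadraticModCube.card_mul_sineSum (natCast_mem (pIntegral p) r)).ratCongr h2 ht
  have hone := sineSum_card_add_ratCongr h2 hr
  rw [sineSign_card_add h2 hr] at hone
  rw [mul_zero, add_zero, hsmall r hr, hneg] at h
  have h' : RatCongr p 2 (sineSum p (r + p * t)) ((1 - t ^ 2) * sineSign r +
      1 / 2 * (t ^ 2 + t) * sineSum p ((p + r : ℕ) : ℚ) +
      1 / 2 * (t ^ 2 - t) * -sineSign (p - 1 - r)) := by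
    refine RatCongr.of_prime_mul ?_
    convert h using 1
    push_cast
    rw [mul_one, add_comm (r : ℚ) p]
    ring
  refine h'.trans ?_
  convert ((RatCongr.refl (p := p) 2 ((1 - t ^ 2) * sineSign r)).add (hone.const_mul
    (mul_mem (half_mem_pIntegral h2) (add_mem (pow_mem ht 2) ht)))).add
    (RatCongr.refl 2 (1 / 2 * (t ^ 2 - t) * -sineSign (p - 1 - r))) using 1
  ring

theorem eulerDiff_ratCongr (h2 : p ≠ 2) {n : ℕ} {x y : ℚ} (hx : x ∈ pIntegral p)
    (hy : y ∈ pIntegral p) (h : RatCongr p n x y) :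
    RatCongr p n (eulerDiff p x) (eulerDiff p y) := by
  have hh := half_mem_pIntegral h2
  have h1 := one_mem (pIntegral p)
  have ha := RatCongr.eulerPolynomial_eval h2 (mul_mem hh (neg_mem hx)) (mul_mem hh (neg_mem hy))
    (h.neg.const_mul hh) (p - 2)
  have hb := RatCongr.eulerPolynomial_eval h2 (mul_mem hh (add_mem h1 hx))
    (mul_mem hh (add_mem h1 hy)) (((RatCongr.refl n 1).add h).const_mul hh) (p - 2)
  convert ha.sub hb using 1 <;> · rw [eulerDiff]; congr 2 <;> ring

theorem eulerDiff_mem_pIntegral (h2 : p ≠ 2) {x : ℚ} (hx : x ∈ pIntegral p) :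
    eulerDiff p x ∈ pIntegral p := by
  have hh := half_mem_pIntegral h2
  have ha := eulerPolynomial_eval_mem_pIntegral h2 (mul_mem hh (neg_mem hx)) (p - 2)
  have hb := eulerPolynomial_eval_mem_pIntegral h2 (mul_mem hh (add_mem (one_mem _) hx)) (p - 2)
  convert sub_mem ha hb using 1
  rw [eulerDiff]; congr 2 <;> ring

theorem sineSign_mem_pIntegral (n : ℕ) : sineSign n ∈ pIntegral p :=
  pow_mem (neg_mem (one_mem _)) _

/-- The value modulo `p ^ 2` at `-1/m = r - (s/m) p`. -/
theorem sineSum_padicCongr (h2 : p ≠ 2) {m r s : ℕ} (hm : ¬ p ∣ m) (hr : r < p)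
    (hs : m * r + 1 = s * p) {c y : ℚ} (hc : c ∈ pIntegral p)
    (hy : y = c * (sineSign r - s / m * (sineSign r + sineSign (p - 1 - r)) +
      1 / 2 * (s / m * (1 - s / m)) * (p * eulerDiff p (-1 / m)))) :
    PadicCongr p 2 (c * sineSum p (-1 / m)) y := by
  have hm0 := natCast_ne_zero_of_not_dvd hm
  have ht : -((s : ℚ) / m) ∈ pIntegral p := neg_mem (div_natCast_mem_pIntegral hm (natCast_mem _ s))
  have ha : (-1 : ℚ) / m ∈ pIntegral p := div_natCast_mem_pIntegral hm (neg_mem (one_mem _))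
  have hs' : (m : ℚ) * r + 1 = s * p := by exact_mod_cast hs
  have hr' : (r : ℚ) + p * -(s / m) = -1 / m := by
    field_simp
    linear_combination hs'
  -- Modulo p suffices to move `eulerDiff` from r to -1/m, because it is multiplied by p.
  have h1 : RatCongr p 1 (r : ℚ) (-1 / m) := ⟨s / m, by simpa using neg_mem ht, by
    rw [← hr']; ring⟩
  have h := sineSum_add_card_mul_ratCongr h2 hr ht
  rw [hr'] at h
  have hw : 1 / 2 * (-((s : ℚ) / m) * (-(s / m) + 1)) ∈ pIntegral p :=
    mul_mem (half_mem_pIntegral h2) (mul_mem ht (add_mem ht (one_mem _)))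
  have he := ((eulerDiff_ratCongr h2 (natCast_mem _ r) ha h1).prime_mul).const_mul hw
  have hfin := (h.trans ((RatCongr.refl 2 _).sub he)).const_mul hc
  have hyv : y = c * (sineSign r + -((s : ℚ) / m) * (sineSign r + sineSign (p - 1 - r)) -
      1 / 2 * (-((s : ℚ) / m) * (-(s / m) + 1)) * (p * eulerDiff p (-1 / m))) := by
    rw [hy]; ring
  rw [← hyv] at hfin
  refine PadicCongr.of_ratCongr ?_ hfin
  rw [hyv]
  have hv := sineSign_mem_pIntegral (p := p)
  exact mul_mem hc (sub_mem (add_mem (hv _) (mul_mem ht (add_mem (hv _) (hv _))))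
    (mul_mem hw (mul_mem (natCast_mem _ _) (eulerDiff_mem_pIntegral h2 ha))))

theorem legendreSym_three (h3 : 3 < p) :
    legendreSym p 3 = if p % 12 = 1 ∨ p % 12 = 11 then 1 else -1 := by
  have h := legendreSym.quadratic_reciprocity' (p := 3) (q := p) (by norm_num) (by omega)
  have hodd := hp.out.eq_two_or_odd
  have hd : ¬ 3 ∣ p := fun hd => by
    have := (Nat.prime_dvd_prime_iff_eq Nat.prime_three hp.out).1 hd
    omega
  have h1 : legendreSym 3 1 = 1 := by decide
  have h2 : legendreSym 3 2 = -1 := by decide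
  rw [legendreSym.mod 3, show (3 : ℕ) / 2 = 1 from rfl, one_mul] at h
  have hcases : p % 12 = 1 ∨ p % 12 = 5 ∨ p % 12 = 7 ∨ p % 12 = 11 := by omega
  have hmod : ((p : ℤ) % (3 : ℕ)) = ((p % 3 : ℕ) : ℤ) := by push_cast; rfl
  have e : legendreSym p 3 = legendreSym p ((3 : ℕ) : ℤ) := rfl
  rw [e, h, hmod]
  rcases hcases with hc | hc | hc | hc
  · rw [show p % 3 = 1 by omega, Even.neg_one_pow (Nat.even_iff.2 (by omega)), if_pos (by omega)]
    simp
  · rw [show p % 3 = 2 by omega, Even.neg_one_pow (Nat.even_iff.2 (by omega)), if_neg (by omega)]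
    simpa using h2
  · rw [show p % 3 = 1 by omega, Odd.neg_one_pow (Nat.odd_iff.2 (by omega)), if_neg (by omega)]
    simp
  · rw [show p % 3 = 2 by omega, Odd.neg_one_pow (Nat.odd_iff.2 (by omega)), if_pos (by omega)]
    simp [h2]

end SineSum

/-! ### Evaluation at -1/4, -1/3 and -1/6 -/

theorem sineSign_eq {n b : ℕ} (h : n / 2 % 2 = b % 2) : sineSign n = (-1) ^ b :=
  neg_one_pow_congr (by rw [Nat.even_iff, Nat.even_iff, h])

theorem sineSign_eq_neg {n b : ℕ} (h : (n / 2 + 1) % 2 = b % 2) : sineSign n = -(-1) ^ b := by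
  rw [← neg_neg (sineSign n), ← sineSign_add_two, sineSign_eq (b := b) (by omega)]

theorem sum_choose_four_mul (p : ℕ) :
    ∑ k ∈ Finset.range p, ((4 * k).choose (2 * k) : ℚ) / ((2 * (k : ℚ) + 1) * 32 ^ k) =
      2 * sineSum p (-1 / (4 : ℕ)) := by
  rw [sineSum, Finset.mul_sum]
  exact Finset.sum_congr rfl fun k _ => choose_four_mul_eq k

theorem sum_choose_three_mul (p : ℕ) :
    ∑ k ∈ Finset.range p, ((3 * k).choose k : ℚ) / (2 * (k : ℚ) + 1) * (2 / 27) ^ k =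
      3 * sineSum p (-1 / (3 : ℕ)) := by
  rw [sineSum, Finset.mul_sum]
  exact Finset.sum_congr rfl fun k _ => choose_three_mul_eq k

theorem sum_choose_six_mul (p : ℕ) :
    ∑ k ∈ Finset.range p, ((6 * k).choose (3 * k) : ℚ) * ((3 * k).choose k : ℚ) /
        ((2 * (k : ℚ) + 1) * 216 ^ k * ((2 * k).choose k : ℚ)) =
      3 / 2 * sineSum p (-1 / (6 : ℕ)) := by
  rw [sineSum, Finset.mul_sum]
  exact Finset.sum_congr rfl fun k _ => choose_six_mul_eq k

theorem sum_choose_four_mul_padicCongr (p : ℕ) [hp : Fact p.Prime] (h2 : p ≠ 2) :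
    PadicCongr p 2
      (∑ k ∈ Finset.range p, ((4 * k).choose (2 * k) : ℚ) / ((2 * (k : ℚ) + 1) * 32 ^ k))
      (3 / 16 * (p : ℚ) *
          ((eulerPolynomial (p - 2)).eval (1 / 8) - (eulerPolynomial (p - 2)).eval (3 / 8)) +
        (if p % 8 = 1 ∨ p % 8 = 7 then 1 else 2) * ((legendreSym p (-1) : ℚ) * (-1) ^ (p / 8))) := by
  have hodd := hp.out.eq_two_or_odd
  have h0 := hp.out.pos
  have hm : ¬ p ∣ 4 := fun h => not_dvd_two h2 (hp.out.dvd_of_dvd_pow (show p ∣ 2 ^ 2 from h))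
  have he : eulerDiff p (-1 / (4 : ℕ)) =
      (eulerPolynomial (p - 2)).eval (1 / 8) - (eulerPolynomial (p - 2)).eval (3 / 8) := by
    rw [eulerDiff]; congr 2 <;> norm_num
  rw [sum_choose_four_mul, ← he, legendreSym.at_neg_one h2]
  have hc : (2 : ℚ) ∈ pIntegral p := natCast_mem _ 2
  have hcases : p % 8 = 1 ∨ p % 8 = 3 ∨ p % 8 = 5 ∨ p % 8 = 7 := by omega
  rcases hcases with h | h | h | h
  -- Here s is the inverse of p modulo 4. The coefficient s/4·(1 - s/4) = 3/16 is the same for s = 1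
  -- and s = 3. Equal signs σ at r and p-1-r give 2(1 - s/2)σ = ±σ, opposite signs give 2σ.
  · refine sineSum_padicCongr h2 (r := (p - 1) / 4) (s := 1) hm (by omega) (by omega) hc ?_
    rw [sineSign_eq (n := (p - 1) / 4) (b := p / 8) (by omega),
      sineSign_eq (n := p - 1 - (p - 1) / 4) (b := p / 8) (by omega),
      ZMod.χ₄_nat_one_mod_four (by omega), if_pos (by omega)]
    push_cast; ring
  · refine sineSum_padicCongr h2 (r := (3 * p - 1) / 4) (s := 3) hm (by omega) (by omega) hc ?_
    rw [sineSign_eq_neg (n := (3 * p - 1) / 4) (b := p / 8) (by omega),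
      sineSign_eq (n := p - 1 - (3 * p - 1) / 4) (b := p / 8) (by omega),
      ZMod.χ₄_nat_three_mod_four (by omega), if_neg (by omega)]
    push_cast; ring
  · refine sineSum_padicCongr h2 (r := (p - 1) / 4) (s := 1) hm (by omega) (by omega) hc ?_
    rw [sineSign_eq (n := (p - 1) / 4) (b := p / 8) (by omega),
      sineSign_eq_neg (n := p - 1 - (p - 1) / 4) (b := p / 8) (by omega),
      ZMod.χ₄_nat_one_mod_four (by omega), if_neg (by omega)]
    push_cast; ring
  · refine sineSum_padicCongr h2 (r := (3 * p - 1) / 4) (s := 3) hm (by omega) (by omega) hc ?_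
    rw [sineSign_eq (n := (3 * p - 1) / 4) (b := p / 8) (by omega),
      sineSign_eq (n := p - 1 - (3 * p - 1) / 4) (b := p / 8) (by omega),
      ZMod.χ₄_nat_three_mod_four (by omega), if_pos (by omega)]
    push_cast; ring

theorem sum_choose_three_mul_padicCongr (p : ℕ) [hp : Fact p.Prime] (h3 : 3 < p) :
    PadicCongr p 2
      (∑ k ∈ Finset.range p, ((3 * k).choose k : ℚ) / (2 * (k : ℚ) + 1) * (2 / 27) ^ k)
      (-1 + 2 * (legendreSym p 3 : ℚ) +
        (p : ℚ) / 3 *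
          ((eulerPolynomial (p - 2)).eval (1 / 6) - (eulerPolynomial (p - 2)).eval (1 / 3))) := by
  have hodd := hp.out.eq_two_or_odd
  have h2 : p ≠ 2 := by omega
  have hm : ¬ p ∣ 3 := Nat.not_dvd_of_pos_of_lt (by norm_num) h3
  have hd : ¬ 3 ∣ p := fun hd => by
    have := (Nat.prime_dvd_prime_iff_eq Nat.prime_three hp.out).1 hd
    omega
  have he : eulerDiff p (-1 / (3 : ℕ)) =
      (eulerPolynomial (p - 2)).eval (1 / 6) - (eulerPolynomial (p - 2)).eval (1 / 3) := by
    rw [eulerDiff]; congr 2 <;> norm_num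
  rw [sum_choose_three_mul, ← he, legendreSym_three h3]
  have hc : (3 : ℚ) ∈ pIntegral p := natCast_mem _ 3
  have hcases : p % 12 = 1 ∨ p % 12 = 5 ∨ p % 12 = 7 ∨ p % 12 = 11 := by omega
  rcases hcases with h | h | h | h
  -- For s = 1, 2 the Euler coefficient is 3/2·2/9 = 1/3. Equal signs σ give ±σ, opposite signs give
  -- 3σ, hence the values 1 and -3 of -1 + 2(3/p).
  · refine sineSum_padicCongr h2 (r := (p - 1) / 3) (s := 1) hm (by omega) (by omega) hc ?_
    rw [sineSign_eq (n := (p - 1) / 3) (b := 0) (by omega),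
      sineSign_eq (n := p - 1 - (p - 1) / 3) (b := 0) (by omega), if_pos (by omega)]
    push_cast; ring
  · refine sineSum_padicCongr h2 (r := (2 * p - 1) / 3) (s := 2) hm (by omega) (by omega) hc ?_
    rw [sineSign_eq_neg (n := (2 * p - 1) / 3) (b := 0) (by omega),
      sineSign_eq (n := p - 1 - (2 * p - 1) / 3) (b := 0) (by omega), if_neg (by omega)]
    push_cast; ring
  · refine sineSum_padicCongr h2 (r := (p - 1) / 3) (s := 1) hm (by omega) (by omega) hc ?_
    rw [sineSign_eq_neg (n := (p - 1) / 3) (b := 0) (by omega),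
      sineSign_eq (n := p - 1 - (p - 1) / 3) (b := 0) (by omega), if_neg (by omega)]
    push_cast; ring
  · refine sineSum_padicCongr h2 (r := (2 * p - 1) / 3) (s := 2) hm (by omega) (by omega) hc ?_
    rw [sineSign_eq_neg (n := (2 * p - 1) / 3) (b := 0) (by omega),
      sineSign_eq_neg (n := p - 1 - (2 * p - 1) / 3) (b := 0) (by omega), if_pos (by omega)]
    push_cast; ring

theorem sum_choose_six_mul_padicCongr (p : ℕ) [hp : Fact p.Prime] (h3 : 3 < p) :
    PadicCongr p 2
      (∑ k ∈ Finset.range p, ((6 * k).choose (3 * k) : ℚ) * ((3 * k).choose k : ℚ) /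
        ((2 * (k : ℚ) + 1) * 216 ^ k * ((2 * k).choose k : ℚ)))
      ((legendreSym p 2 : ℚ) +
        5 * (p : ℚ) / 48 *
          ((eulerPolynomial (p - 2)).eval (1 / 12) -
            (eulerPolynomial (p - 2)).eval (5 / 12))) := by
  have hodd := hp.out.eq_two_or_odd
  have h2 : p ≠ 2 := by omega
  have hm3 : ¬ p ∣ 3 := Nat.not_dvd_of_pos_of_lt (by norm_num) h3
  have hm : ¬ p ∣ 6 := fun h =>
    (hp.out.dvd_mul.1 (show p ∣ 2 * 3 from h)).elim (not_dvd_two h2) hm3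
  have hd : ¬ 3 ∣ p := fun hd => by
    have := (Nat.prime_dvd_prime_iff_eq Nat.prime_three hp.out).1 hd
    omega
  have he : eulerDiff p (-1 / (6 : ℕ)) =
      (eulerPolynomial (p - 2)).eval (1 / 12) - (eulerPolynomial (p - 2)).eval (5 / 12) := by
    rw [eulerDiff]; congr 2 <;> norm_num
  rw [sum_choose_six_mul, ← he, legendreSym.at_two h2, ZMod.χ₈_nat_eq_if_mod_eight,
    if_neg (by omega)]
  have hc : (3 / 2 : ℚ) ∈ pIntegral p :=
    div_natCast_mem_pIntegral (not_dvd_two h2) (natCast_mem _ 3)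
  have hcases : p % 6 = 1 ∨ p % 6 = 5 := by omega
  rcases hcases with h | h <;> by_cases h8 : p % 8 = 1 ∨ p % 8 = 7
  -- The signs at r and p-1-r always agree here, so the main term is 3/2·(1 - s/3)σ = ±σ for s = 1,
  -- 5; the Euler coefficient is 3/4·5/36 = 5/48.
  · refine sineSum_padicCongr h2 (r := (p - 1) / 6) (s := 1) hm (by omega) (by omega) hc ?_
    rw [sineSign_eq (n := (p - 1) / 6) (b := 0) (by omega),
      sineSign_eq (n := p - 1 - (p - 1) / 6) (b := 0) (by omega), if_pos h8]
    push_cast; ring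
  · refine sineSum_padicCongr h2 (r := (p - 1) / 6) (s := 1) hm (by omega) (by omega) hc ?_
    have h8' : p % 8 = 3 ∨ p % 8 = 5 := by omega
    rw [sineSign_eq_neg (n := (p - 1) / 6) (b := 0) (by omega),
      sineSign_eq_neg (n := p - 1 - (p - 1) / 6) (b := 0) (by omega), if_neg h8]
    push_cast; ring
  · refine sineSum_padicCongr h2 (r := (5 * p - 1) / 6) (s := 5) hm (by omega) (by omega) hc ?_
    rw [sineSign_eq_neg (n := (5 * p - 1) / 6) (b := 0) (by omega),
      sineSign_eq_neg (n := p - 1 - (5 * p - 1) / 6) (b := 0) (by omega), if_pos h8]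
    push_cast; ring
  · refine sineSum_padicCongr h2 (r := (5 * p - 1) / 6) (s := 5) hm (by omega) (by omega) hc ?_
    have h8' : p % 8 = 3 ∨ p % 8 = 5 := by omega
    rw [sineSign_eq (n := (5 * p - 1) / 6) (b := 0) (by omega),
      sineSign_eq (n := p - 1 - (5 * p - 1) / 6) (b := 0) (by omega), if_neg h8]
    push_cast; ring

theorem corollary1p5 (p : ℕ) [Fact p.Prime] (hp : p ≠ 2) :
    (p % 8 = 1 ∨ p % 8 = 7 →
      PadicCongr p 2
        (∑ k ∈ Finset.range p, ((4 * k).choose (2 * k) : ℚ) / ((2 * (k : ℚ) + 1) * 32 ^ k))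
        (3 / 16 * (p : ℚ) *
            ((eulerPolynomial (p - 2)).eval (1 / 8) - (eulerPolynomial (p - 2)).eval (3 / 8)) +
          (legendreSym p (-1) : ℚ) * (-1) ^ (p / 8))) ∧
    (p % 8 = 3 ∨ p % 8 = 5 →
      PadicCongr p 2
        (∑ k ∈ Finset.range p, ((4 * k).choose (2 * k) : ℚ) / ((2 * (k : ℚ) + 1) * 32 ^ k))
        (3 / 16 * (p : ℚ) *
            ((eulerPolynomial (p - 2)).eval (1 / 8) - (eulerPolynomial (p - 2)).eval (3 / 8)) +
          2 * (legendreSym p (-1) : ℚ) * (-1) ^ (p / 8))) ∧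
    (3 < p →
      PadicCongr p 2
        (∑ k ∈ Finset.range p, ((3 * k).choose k : ℚ) / (2 * (k : ℚ) + 1) * (2 / 27) ^ k)
        (-1 + 2 * (legendreSym p 3 : ℚ) +
          (p : ℚ) / 3 *
            ((eulerPolynomial (p - 2)).eval (1 / 6) - (eulerPolynomial (p - 2)).eval (1 / 3))) ∧
      PadicCongr p 2
        (∑ k ∈ Finset.range p, ((6 * k).choose (3 * k) : ℚ) * ((3 * k).choose k : ℚ) /
          ((2 * (k : ℚ) + 1) * 216 ^ k * ((2 * k).choose k : ℚ)))
        ((legendreSym p 2 : ℚ) +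
          5 * (p : ℚ) / 48 *
            ((eulerPolynomial (p - 2)).eval (1 / 12) -
              (eulerPolynomial (p - 2)).eval (5 / 12)))) := by
  have h4 := sum_choose_four_mul_padicCongr p hp
  refine ⟨fun h => ?_, fun h => ?_, fun h3 =>
    ⟨sum_choose_three_mul_padicCongr p h3, sum_choose_six_mul_padicCongr p h3⟩⟩
  · rwa [if_pos h, one_mul] at h4
  · rwa [if_neg (by omega), ← mul_assoc] at h4
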